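/- \textbf{Theorem 1.} Consider a network with users $1,2,3$ and node $4$. Let $n_{i4}$ and $n_{4i}$ ($i\in\{1,2,3\}$) be nonnegative integers, where $n_{i4}$ and $n_{4i}$ need not be equal (non-reciprocal channels), let $q$ be the largest of these six numbers, and let $S$ be the $q\times q$ lower shift matrix over $\mathbb F_2$. One network use consists of an uplink phase, in which user $i$ sends $x_i\in\mathbb F_2^q$ and node $4$ receives $y_4=\sum_{i=1}^3 S^{q-n_{i4}}x_i$, followed by a downlink phase, in which node $4$ sends $x_4\in\mathbb F_2^q$ and user $i$ receives $y_i=S^{q-n_{4i}}x_4$; there are no other links. Each node $i\in\{1,2,3,4\}$ has an independent private message for every other node $j$, uniformly distributed on a set of $\lceil 2^{NR_{ij}}\rceil$ elements, where $N$ is the number of network uses and $R_{ij}\ge 0$ is the rate from node $i$ to node $j$. Every transmitted signal is a function of the messages originating at the transmitting node and of all the signals that this node has received so far, and each node decodes the messages intended for it from its own messages and all its received signals. A tuple $(R_{ij})_{i\ne j}$ is achievable if there are such codes, for all $N$, for which the probability that some message is decoded wrongly tends to $0$ as $N\to\infty$; the capacity region is the closure of the set of achievable tuples. Let $(u,v,t)$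 and $(w,y,z)$ be orderings of $\{1,2,3\}$ with $n_{u4}\ge n_{v4}\ge n_{t4}$ and $n_{4w}\ge n_{4y}\ge n_{4z}$. Then the capacity region is exactly the set of tuples $(R_{ij})_{i\neq j}$ of nonnegative reals that satisfy \begin{align*} R_{tu}+R_{tv}+R_{t4}&\le n_{t4},\\ R_{wz}+R_{yz}+R_{4z}&\le n_{4z},\\ R_{t4}+R_{v4}+R_{tu}+R_{vu}+\max(R_{tv},R_{vt})&\le n_{v4},\\ R_{4z}+R_{4y}+R_{wz}+R_{wy}+\max(R_{zy},R_{yz})&\le n_{4y},\\ R_{u4}+R_{v4}+R_{t4}+R_{uv}+R_{ut}+\max(R_{tv},R_{vt})&\le n_{u4},\\ R_{u4}+R_{v4}+R_{t4}+R_{vu}+R_{vt}+\max(R_{tu},R_{ut})&\le n_{u4},\\ R_{u4}+R_{v4}+R_{t4}+R_{tu}+R_{tv}+\max(R_{uv},R_{vu})&\le n_{u4},\\ R_{4w}+R_{4y}+R_{4z}+R_{wz}+R_{yz}+\max(R_{wy},R_{yw})&\le n_{4w},\\ R_{4w}+R_{4y}+R_{4z}+R_{yw}+R_{zw}+\max(R_{zy},R_{yz})&\le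 n_{4w},\\ R_{4w}+R_{4y}+R_{4z}+R_{wy}+R_{zy}+\max(R_{wz},R_{zw})&\le n_{4w}. \end{align*} -/

import Mathlib

open Filter Topology

namespace FourNode

/-- The four nodes: `some 0`, `some 1`, `some 2` are the nodes 1, 2, 3 (the users) and `none` is
node 4. A user `i : Fin 3` is silently coerced to a node. -/
abbrev Node := Option (Fin 3)

/-- Node 4. -/
abbrev node4 : Node := none

/-- The gains (numbers of signal levels) of the deterministic network: `up i` is `n_{i4}`, from
user `i` to node 4, and `down i` is `n_{4i}`, from node 4 to user `i`. -/
structure Network where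
  up : Fin 3 → ℕ
  down : Fin 3 → ℕ

/-- The length `q` of all channel vectors, the largest of the six gains. -/
def Network.q (net : Network) : ℕ :=
  Finset.univ.sup net.up ⊔ Finset.univ.sup net.down

/-- A channel input or output: `q` bits, index `0` being the most significant level. -/
abbrev Network.Signal (net : Network) := Fin net.q → ZMod 2

/-- The linear deterministic point-to-point channel of gain `n`: multiplication by `S ^ (q - n)`,
where `S` is the `q × q` lower shift matrix. The `n` most significant bits of the input arrive, in
order, on the `n` lowest levels, and the other bits are lost below the noise level. -/
def Network.shift (net : Network) (n : ℕ) (x : net.Signal) : net.Signal := fun j =>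
  if net.q - n ≤ (j : ℕ) then x ⟨(j : ℕ) - (net.q - n), lt_of_le_of_lt (Nat.sub_le _ _) j.isLt⟩
  else 0

/-- Uplink: node 4 receives the sum over `F₂` of the shifted inputs of the three users. -/
def Network.uplink (net : Network) (x : Fin 3 → net.Signal) : net.Signal :=
  ∑ i, net.shift (net.up i) (x i)

/-- Downlink: user `i` receives the shifted input of node 4. -/
def Network.downlink (net : Network) (x : net.Signal) (i : Fin 3) : net.Signal :=
  net.shift (net.down i) x

/-- A choice of all messages. `W i j` is the private message from node `i` to node `j`, one out of
`M i j` possible ones. -/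
abbrev Messages (M : Node → Node → ℕ) := ∀ i j, Fin (M i j)

/-- Encoders and decoders. Every node uses its own messages and everything it has received so far
(a list, most recent signal first, whose length tells the time). The decoder of node `j` outputs
an estimate of the message from `i` to `j` for every `i`. -/
structure Code (net : Network) (M : Node → Node → ℕ) where
  userEnc : ∀ i : Fin 3, (∀ j, Fin (M i j)) → List net.Signal → net.Signal
  relayEnc : (∀ j, Fin (M node4 j)) → List net.Signal → net.Signal
  dec : ∀ j : Node, (∀ k, Fin (M j k)) → List net.Signal → ∀ i, Fin (M i j)

variable {net : Network} {M : Node → Node → ℕ}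

/-- What each node has received during the first `k` network uses, most recent signal first.
One network use is one use of the uplink, in which the users transmit and node 4 receives,
followed by one use of the downlink, in which node 4 transmits and the users receive. -/
def Code.received (C : Code net M) (W : Messages M) : ℕ → Node → List net.Signal
  | 0 => fun _ => []
  | k + 1 =>
    let past := C.received W k
    let atRelay : List net.Signal :=
      net.uplink (fun i => C.userEnc i (W i) (past i)) :: past node4
    let sent : net.Signal := C.relayEnc (W node4) atRelay
    fun j => match j with
      | none => atRelay
      | some i => net.downlink sent i :: past i

/-- After `N` network uses every node recovers all the messages intended for it. -/
def Code.Correct (C : Code net M) (N : ℕ) (W : Messages M) : Prop :=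
  ∀ j i, C.dec j (W j) (C.received W N j) i = W i j

/-- The probability that some message is decoded wrongly after `N` network uses, the messages being
independent and uniformly distributed. -/
noncomputable def Code.errorProb (C : Code net M) (N : ℕ) : ℝ :=
  (Nat.card {W : Messages M // ¬ C.Correct N W} : ℝ) / (Nat.card (Messages M) : ℝ)

/-- The numbers `⌈2 ^ (N R_{ij})⌉` of messages for block length `N` and rates `R` in bits per
network use. -/
noncomputable def numMessages (R : Node → Node → ℝ) (N : ℕ) : Node → Node → ℕ :=
  fun i j => ⌈(2 : ℝ) ^ ((N : ℝ) * R i j)⌉₊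

/-- A rate tuple assigns a nonnegative rate `R i j` to each pair of distinct nodes. A node sends
nothing to itself, so the diagonal entries are `0`. -/
def IsRateTuple (R : Node → Node → ℝ) : Prop :=
  (∀ i j, 0 ≤ R i j) ∧ ∀ i, R i i = 0

/-- `R` is achievable if there are codes of all block lengths, with `⌈2 ^ (N R_{ij})⌉` messages
from `i` to `j` at block length `N`, whose error probability tends to `0`. -/
def Network.Achievable (net : Network) (R : Node → Node → ℝ) : Prop :=
  ∃ C : ∀ N : ℕ, Code net (numMessages R N), Tendsto (fun N => (C N).errorProb N) atTop (𝓝 0)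

/-- The capacity region: the closure of the set of achievable rate tuples. -/
def Network.capacityRegion (net : Network) : Set (Node → Node → ℝ) :=
  closure {R | IsRateTuple R ∧ net.Achievable R}

end FourNode

/-!
Both halves of the proof rest on the same fact about orders of the nodes.

Converse. Fix a rank function `ρ` on the nodes and all messages that do not go from a lower to a
higher rank. A node of the highest rank then knows its own messages and decodes the ones it wants;
hence the outgoing messages of a node of the next rank are known as well, this node can be
simulated, and so on (`eq_of_received_eq`). So every message is a function of what is received. In
the uplink everything received is determined by the part of `y₄` that comes from the users without
a fixed set of messages, in the downlink by the signal of the strongest receiver concerned, and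
counting these observations bounds the total rate along rising pairs by the corresponding gain
(`Network.Achievable.sum_le`). The inequalities of the theorem are the resulting bounds for all
orders. Counting shows that above the bound the probability of correct decoding tends to `0`, so no
entropy inequality is needed.

Achievability. Take `L` network uses as one block, which multiplies all gains by `L`, and round the
demands down to integers. Match bits of opposite directions between two users into pairs until each
pair of users has one direction left, then collect the rest into directed triangles
`i → j → l → i`. The relay needs only the sum of a pair and the sums of two consecutive bits of a
triangle, because each user knows its own bits. A pair takes one level at the weaker of its two
users, and a triangle takes one level at each user but the strongest. The levels reached by the
users are nested, and the counts of levels needed are exactly the left-hand sides of the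
inequalities, so the levels can be allotted (`Fits.exists_placement`). The downlink is the same
problem with all demands reversed. Relay and decoders exist because what they have to produce is
determined by what they know (`exists_code`); forwarding each block during the next one costs one
block (`exists_block_code`), which is negligible for many blocks.
-/

namespace FourNode

/-! ### Converse: counting correctly decoded message tuples -/

section Converse

variable {net : Network} {M : Node → Node → ℕ}

/-- Suppose that two message tuples agree on all pairs of nodes along which `ρ` does not increase,
and that the nodes below which there is some node receive the same signals. Then all nodes decode
the same messages, in the order of decreasing rank: the outgoing messages of a node are either
equal by assumption or incoming messages of a node of higher rank. -/
theorem eq_of_received_eq (C : Code net M) {N : ℕ} {W W' : Messages M} (hW : C.Correct N W)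
    (hW' : C.Correct N W') (ρ : Node → ℕ) (hout : ∀ a b, ρ b ≤ ρ a → W a b = W' a b)
    (hrec : ∀ a b, ρ a < ρ b → C.received W N b = C.received W' N b) : W = W' := by
  have key : ∀ m b, (∀ c, ρ c ≤ m + ρ b) → ∀ a, W a b = W' a b := by
    intro m
    induction m with
    | zero =>
      intro b hb a
      rcases lt_or_ge (ρ a) (ρ b) with h | h
      · have h2 : W b = W' b := by
          funext c
          exact hout _ _ (by simpa using hb c)
        rw [← hW b a, ← hW' b a, h2, hrec a b h]
      · exact hout _ _ h
    | succ m ih =>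
      intro b hb a
      rcases lt_or_ge (ρ a) (ρ b) with h | h
      · have h2 : W b = W' b := by
          funext c
          rcases lt_or_ge (ρ b) (ρ c) with h3 | h3
          · exact ih c (fun d => by have := hb d; omega) b
          · exact hout _ _ h3
        rw [← hW b a, ← hW' b a, h2, hrec a b h]
      · exact hout _ _ h
  funext a b
  refine key (Finset.univ.sup ρ) b (fun c => ?_) a
  exact le_add_right (Finset.le_sup (f := ρ) (Finset.mem_univ c))

/-- If, given the messages outside `E`, an observation of `n` bits per network use determines the
correctly decoded tuples, then there are few such tuples. -/
theorem card_correct_mul_le (C : Code net M) {N n : ℕ} (E : Finset (Node × Node))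
    (obs : Messages M → Fin N → Fin n → ZMod 2)
    (h : ∀ W W', C.Correct N W → C.Correct N W' → (∀ a b, (a, b) ∉ E → W a b = W' a b) →
      obs W = obs W' → W = W') :
    Nat.card {W : Messages M // C.Correct N W} * ∏ e ∈ E, M e.1 e.2 ≤
      Nat.card (Messages M) * 2 ^ (N * n) := by
  classical
  let f : {W : Messages M // C.Correct N W} →
      (∀ e : {e : Node × Node // e ∉ E}, Fin (M e.1.1 e.1.2)) × (Fin N → Fin n → ZMod 2) :=
    fun W => (fun e => W.1 e.1.1 e.1.2, obs W.1)
  have hf : Function.Injective f := by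
    intro W W' hWW
    refine Subtype.ext (h _ _ W.2 W'.2 (fun a b hab => ?_) (congrArg Prod.snd hWW))
    exact congrFun (congrArg Prod.fst hWW) ⟨(a, b), hab⟩
  have h1 := Nat.card_le_card_of_injective f hf
  have h2 : Nat.card ((∀ e : {e : Node × Node // e ∉ E}, Fin (M e.1.1 e.1.2)) ×
      (Fin N → Fin n → ZMod 2)) = (∏ e ∈ Eᶜ, M e.1 e.2) * 2 ^ (N * n) := by
    rw [Nat.card_prod, Nat.card_pi]
    congr 1
    · simp only [Nat.card_eq_fintype_card, Fintype.card_fin]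
      exact (Finset.prod_subtype Eᶜ (by simp) (fun e : Node × Node => M e.1 e.2)).symm
    · simp [Nat.card_eq_fintype_card, pow_mul, mul_comm N n]
  have h3 : Nat.card (Messages M) = (∏ e ∈ Eᶜ, M e.1 e.2) * ∏ e ∈ E, M e.1 e.2 := by
    rw [mul_comm, Finset.prod_mul_prod_compl, Fintype.prod_prod_type, Nat.card_pi]
    simp
  rw [h3, mul_right_comm]
  exact Nat.mul_le_mul_right _ (h1.trans h2.le)

/-- The bound by counting: if `n` bits per network use determine the messages in `E`, the total rate
of `E` is at most `n`. Above `n` even the probability of correct decoding would tend to `0`. -/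
theorem Network.Achievable.sum_le {R : Node → Node → ℝ} (hR : net.Achievable R)
    (E : Finset (Node × Node)) (n : ℕ)
    (h : ∀ (M : Node → Node → ℕ) (C : Code net M) (N : ℕ),
      ∃ obs : Messages M → Fin N → Fin n → ZMod 2,
      ∀ W W', C.Correct N W → C.Correct N W' → (∀ a b, (a, b) ∉ E → W a b = W' a b) →
        obs W = obs W' → W = W') :
    ∑ e ∈ E, R e.1 e.2 ≤ n := by
  by_contra! hlt
  obtain ⟨C, hC⟩ := hR
  set s := ∑ e ∈ E, R e.1 e.2 with hs
  have hpos : ∀ N i j, 0 < numMessages R N i j := fun N i j => Nat.ceil_pos.2 (by positivity)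
  have bound : ∀ N, 1 - (C N).errorProb N ≤ ((2 : ℝ) ^ ((n : ℝ) - s)) ^ N := by
    intro N
    obtain ⟨obs, hobs⟩ := h _ (C N) N
    have h1 := card_correct_mul_le (C N) E obs hobs
    have hcard : Nat.card {W : Messages (numMessages R N) // (C N).Correct N W} +
        Nat.card {W : Messages (numMessages R N) // ¬ (C N).Correct N W} =
          Nat.card (Messages (numMessages R N)) := by
      classical
      simp only [Nat.card_eq_fintype_card]
      rw [Fintype.card_subtype_compl]
      exact Nat.add_sub_cancel' (Fintype.card_subtype_le _)
    have hMpos : 0 < Nat.card (Messages (numMessages R N)) := by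
      rw [Nat.card_pi]
      refine Finset.prod_pos fun i _ => ?_
      rw [Nat.card_pi]
      exact Finset.prod_pos fun j _ => by simpa using hpos N i j
    have hprod : (2 : ℝ) ^ (N * s) ≤ ∏ e ∈ E, (numMessages R N e.1 e.2 : ℝ) := by
      rw [hs, Finset.mul_sum, Real.rpow_sum_of_pos (by norm_num)]
      exact Finset.prod_le_prod (fun _ _ => by positivity) fun e _ => Nat.le_ceil _
    have h1' : (Nat.card {W : Messages (numMessages R N) // (C N).Correct N W} : ℝ) *
        ∏ e ∈ E, (numMessages R N e.1 e.2 : ℝ) ≤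
          Nat.card (Messages (numMessages R N)) * 2 ^ (N * n) := by exact_mod_cast h1
    have hcard' : (Nat.card {W : Messages (numMessages R N) // (C N).Correct N W} : ℝ) +
        Nat.card {W : Messages (numMessages R N) // ¬ (C N).Correct N W} =
          Nat.card (Messages (numMessages R N)) := by exact_mod_cast hcard
    have hMpos' : (0 : ℝ) < Nat.card (Messages (numMessages R N)) := by exact_mod_cast hMpos
    have e1 : 1 - (C N).errorProb N =
        Nat.card {W : Messages (numMessages R N) // (C N).Correct N W} /
          Nat.card (Messages (numMessages R N)) := by
      rw [Code.errorProb, eq_div_iff hMpos'.ne', sub_mul, div_mul_cancel₀ _ hMpos'.ne']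
      linarith
    have e2 : ((2 : ℝ) ^ ((n : ℝ) - s)) ^ N = 2 ^ (N * n) / (2 : ℝ) ^ (N * s) := by
      rw [← Real.rpow_natCast, ← Real.rpow_mul (by norm_num), ← Real.rpow_natCast (n := N * n),
        ← Real.rpow_sub (by norm_num)]
      congr 1
      push_cast
      ring
    rw [e1, e2, div_le_div_iff₀ hMpos' (by positivity), mul_comm (2 ^ (N * n) : ℝ)]
    exact (mul_le_mul_of_nonneg_left hprod (by positivity)).trans h1'
  have t1 : Tendsto (fun N => 1 - (C N).errorProb N) atTop (𝓝 (1 - 0)) := hC.const_sub 1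
  have t2 : Tendsto (fun N : ℕ => ((2 : ℝ) ^ ((n : ℝ) - s)) ^ N) atTop (𝓝 0) :=
    tendsto_pow_atTop_nhds_zero_of_lt_one (by positivity)
      (Real.rpow_lt_one_of_one_lt_of_neg (by norm_num) (by linarith))
  have := le_of_tendsto_of_tendsto' t1 t2 bound
  norm_num at this

/-- The ordered pairs of nodes along which the rank increases. -/
def risingPairs (ρ : Node → ℕ) : Finset (Node × Node) :=
  Finset.univ.filter fun e => ρ e.1 < ρ e.2

theorem mem_risingPairs {ρ : Node → ℕ} {a b : Node} : (a, b) ∈ risingPairs ρ ↔ ρ a < ρ b := by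
  simp [risingPairs]

theorem Network.up_le_q (net : Network) (i : Fin 3) : net.up i ≤ net.q :=
  (Finset.le_sup (f := net.up) (Finset.mem_univ i)).trans le_sup_left

theorem Network.down_le_q (net : Network) (i : Fin 3) : net.down i ≤ net.q :=
  (Finset.le_sup (f := net.down) (Finset.mem_univ i)).trans le_sup_right

/-- What node 4 receives is determined by the inputs of the users outside a set `A` and by the
`n` lowest levels of the sum of the inputs from `A`. -/
theorem Network.uplink_congr (net : Network) {n : ℕ} (A : Finset (Fin 3))
    (hn : ∀ i ∈ A, net.up i ≤ n) {x x' : Fin 3 → net.Signal} (hx : ∀ i, i ∉ A → x i = x' i)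
    (hlow : ∀ j : Fin net.q, net.q ≤ n + j →
      (∑ i ∈ A, net.shift (net.up i) (x i)) j = (∑ i ∈ A, net.shift (net.up i) (x' i)) j) :
    net.uplink x = net.uplink x' := by
  classical
  have hA : ∑ i ∈ A, net.shift (net.up i) (x i) = ∑ i ∈ A, net.shift (net.up i) (x' i) := by
    funext j
    by_cases hj : net.q ≤ n + j
    · exact hlow j hj
    · simp only [Finset.sum_apply]
      have hz : ∀ (i) (_ : i ∈ A) (s : net.Signal), net.shift (net.up i) s j = 0 := by
        intro i hi s
        have := hn i hi
        rw [Network.shift, if_neg (by omega)]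
      rw [Finset.sum_eq_zero fun i hi => hz i hi _, Finset.sum_eq_zero fun i hi => hz i hi _]
  unfold Network.uplink
  rw [← Finset.sum_add_sum_compl A, ← Finset.sum_add_sum_compl A, hA]
  congr 1
  exact Finset.sum_congr rfl fun i hi => by rw [hx i (Finset.mem_compl.1 hi)]

/-- If the relay and the users outside `A` have the top rank, then the total rate along rising
pairs is at most the largest uplink gain in `A`. -/
theorem Network.Achievable.uplink_bound {R : Node → Node → ℝ} (hR : net.Achievable R)
    (ρ : Node → ℕ) (A : Finset (Fin 3)) (n : ℕ) (hn : ∀ i ∈ A, net.up i ≤ n)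
    (h4 : ∀ a, ρ a ≤ ρ node4) (hA : ∀ i : Fin 3, i ∉ A → ∀ a, ρ a ≤ ρ i) :
    ∑ e ∈ risingPairs ρ, R e.1 e.2 ≤ n := by
  refine hR.sum_le _ n fun M C N => ?_
  refine ⟨fun W k d => if h : (d : ℕ) < net.q then
    (∑ i ∈ A, net.shift (net.up i) (C.userEnc i (W i) (C.received W k i)))
      ⟨net.q - 1 - d, by omega⟩ else 0, ?_⟩
  intro W W' hW hW' hE hobs
  simp only [mem_risingPairs, not_lt] at hE
  have hrec : ∀ k ≤ N, C.received W k = C.received W' k := by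
    intro k
    induction k with
    | zero => intro _; rfl
    | succ k ih =>
      intro hk
      have ih := ih (by omega)
      have hW4 : W node4 = W' node4 := funext fun b => hE _ _ (h4 b)
      have hup : net.uplink (fun i => C.userEnc i (W i) (C.received W k i)) =
          net.uplink (fun i => C.userEnc i (W' i) (C.received W' k i)) := by
        refine net.uplink_congr A hn (fun i hi => ?_) fun j hj => ?_
        · have : W i = W' i := funext fun b => hE _ _ (hA i hi b)
          simp only [this, ih]
        · have h1 := congrFun (congrFun hobs ⟨k, hk⟩) ⟨net.q - 1 - j, by omega⟩
          have hj' : net.q - 1 - (j : ℕ) < net.q := by omega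
          have hj'' : (⟨net.q - 1 - (net.q - 1 - (j : ℕ)), by omega⟩ : Fin net.q) = j := by
            ext; simp only; omega
          simpa only [hj', dif_pos, hj''] using h1
      funext b
      rw [ih] at hup
      simp only [Code.received, ih, hW4, hup]
  exact eq_of_received_eq C hW hW' ρ hE fun a b _ => by rw [hrec N le_rfl]

/-- A weaker receiver of the downlink sees a function of what a stronger one sees. -/
theorem Network.downlink_congr (net : Network) {i j : Fin 3} (hij : net.down i ≤ net.down j)
    {x x' : net.Signal} (h : net.downlink x j = net.downlink x' j) :
    net.downlink x i = net.downlink x' i := by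
  have hi := net.down_le_q i
  have hj := net.down_le_q j
  funext l
  unfold Network.downlink Network.shift at h ⊢
  split_ifs with hl
  · have := congrFun h ⟨l - (net.q - net.down i) + (net.q - net.down j), by omega⟩
    simpa using this
  · rfl

/-- If the relay and the users outside a set have the lowest rank, then the total rate along
rising pairs is at most the largest downlink gain in that set, attained at the user `m`. -/
theorem Network.Achievable.downlink_bound {R : Node → Node → ℝ} (hR : net.Achievable R)
    (ρ : Node → ℕ) (m : Fin 3) (h4 : ∀ a, ρ node4 ≤ ρ a)
    (hB : ∀ i : Fin 3, net.down i ≤ net.down m ∨ ∀ a, ρ i ≤ ρ a) :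
    ∑ e ∈ risingPairs ρ, R e.1 e.2 ≤ net.down m := by
  refine hR.sum_le _ _ fun M C N => ?_
  have hm := net.down_le_q m
  let sent : Messages M → ℕ → net.Signal := fun W k =>
    C.relayEnc (W node4) (C.received W (k + 1) node4)
  refine ⟨fun W k d => net.downlink (sent W k) m ⟨net.q - 1 - d, by omega⟩, ?_⟩
  intro W W' hW hW' hE hobs
  simp only [mem_risingPairs, not_lt] at hE
  have hdown : ∀ k < N, net.downlink (sent W k) m = net.downlink (sent W' k) m := by
    intro k hk
    funext j
    by_cases hj : net.q - net.down m ≤ j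
    · have h1 := congrFun (congrFun hobs ⟨k, hk⟩) ⟨net.q - 1 - j, by omega⟩
      have hj'' : (⟨net.q - 1 - (net.q - 1 - (j : ℕ)), by omega⟩ : Fin net.q) = j := by
        ext; simp only; omega
      simpa only [hj''] using h1
    · simp only [Network.downlink, Network.shift, if_neg hj]
  refine eq_of_received_eq C hW hW' ρ hE fun a b hab => ?_
  match b with
  | none => exact absurd hab (not_lt.2 (h4 a))
  | some i =>
    have hi : net.down i ≤ net.down m := (hB i).resolve_right fun h => absurd hab (not_lt.2 (h a))
    have hrec : ∀ k ≤ N, C.received W k (some i) = C.received W' k (some i) := by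
      intro k
      induction k with
      | zero => intro _; rfl
      | succ k ih =>
        intro hk
        have h1 := net.downlink_congr hi (hdown k hk)
        have ih := ih (by omega)
        change net.downlink (sent W k) i :: _ = net.downlink (sent W' k) i :: _
        rw [h1, ih]
    exact hrec N le_rfl

/-- A sum over the three users, listed in any order. -/
theorem sum_users {u v t : Fin 3} (huv : u ≠ v) (hut : u ≠ t) (hvt : v ≠ t)
    {α : Type*} [AddCommMonoid α] (f : Fin 3 → α) : ∑ i, f i = f u + f v + f t := by
  have : (Finset.univ : Finset (Fin 3)) = {u, v, t} := by
    revert u v t; decide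
  rw [this, Finset.sum_insert (by simp [huv, hut]), Finset.sum_insert (by simp [hvt]),
    Finset.sum_singleton, add_assoc]

/-- The rank with prescribed values at node 4 and at three users. -/
def rankOf (u v : Fin 3) (r₄ ru rv rt : ℕ) : Node → ℕ
  | none => r₄
  | some i => if i = u then ru else if i = v then rv else rt

theorem rankOf_le {u v : Fin 3} {r₄ ru rv rt m : ℕ} (h₄ : r₄ ≤ m) (hu : ru ≤ m) (hv : rv ≤ m)
    (ht : rt ≤ m) (a : Node) : rankOf u v r₄ ru rv rt a ≤ m := by
  match a with
  | none => exact h₄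
  | some i => simp only [rankOf]; split_ifs <;> assumption

theorem sum_risingPairs (ρ : Node → ℕ) (R : Node → Node → ℝ) {u v t : Fin 3} (huv : u ≠ v)
    (hut : u ≠ t) (hvt : v ≠ t) : ∑ e ∈ risingPairs ρ, R e.1 e.2 =
      ∑ a ∈ ({node4, ↑u, ↑v, ↑t} : Finset Node), ∑ b ∈ ({node4, ↑u, ↑v, ↑t} : Finset Node),
        if ρ a < ρ b then R a b else 0 := by
  have : ({node4, ↑u, ↑v, ↑t} : Finset Node) = Finset.univ := by
    revert u v t; decide
  rw [this, risingPairs, Finset.sum_filter, Fintype.sum_prod_type]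

/-! #### The cut-set and genie-aided bounds, one for each order of decoding -/

theorem Network.Achievable.uplink_three {R : Node → Node → ℝ} (hR : net.Achievable R)
    {i j l : Fin 3} (hij : i ≠ j) (hil : i ≠ l) (hjl : j ≠ l) {n : ℕ} (hn : ∀ i, net.up i ≤ n) :
    R i node4 + R j node4 + R l node4 + R i j + R i l + R j l ≤ n := by
  have := hR.uplink_bound (rankOf i j 3 0 1 2) Finset.univ n (fun i _ => hn i)
    (rankOf_le (m := 3) (by decide) (by decide) (by decide) (by decide)) (by simp)
  rw [sum_risingPairs _ _ hij hil hjl] at this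
  simp [rankOf, hij, hil, hjl, hij.symm, hil.symm, hjl.symm] at this
  linarith

theorem Network.Achievable.uplink_two {R : Node → Node → ℝ} (hR : net.Achievable R)
    {i j l : Fin 3} (hij : i ≠ j) (hil : i ≠ l) (hjl : j ≠ l) {n : ℕ} (hi : net.up i ≤ n)
    (hj : net.up j ≤ n) : R i node4 + R j node4 + R i l + R j l + R i j ≤ n := by
  have := hR.uplink_bound (rankOf i j 2 0 1 2) {i, j} n (by simp [hi, hj])
    (rankOf_le (m := 2) (by decide) (by decide) (by decide) (by decide))
    (fun k hk => by
      simp only [Finset.mem_insert, Finset.mem_singleton, not_or] at hk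
      simpa [rankOf, hk] using rankOf_le (m := 2) (by decide) (by decide) (by decide) (by decide))
  rw [sum_risingPairs _ _ hij hil hjl] at this
  simp [rankOf, hij, hil, hjl, hij.symm, hil.symm, hjl.symm] at this
  linarith

theorem Network.Achievable.uplink_one {R : Node → Node → ℝ} (hR : net.Achievable R)
    {i j l : Fin 3} (hij : i ≠ j) (hil : i ≠ l) (hjl : j ≠ l) :
    R i j + R i l + R i node4 ≤ net.up i := by
  have := hR.uplink_bound (rankOf i j 1 0 1 1) {i} (net.up i) (by simp)
    (rankOf_le (m := 1) (by decide) (by decide) (by decide) (by decide))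
    (fun k hk => by
      simp only [Finset.mem_singleton] at hk
      have h1 : rankOf i j 1 0 1 1 k = 1 := by simp [rankOf, hk]
      rw [h1]
      exact rankOf_le (by decide) (by decide) (by decide) (by decide))
  rw [sum_risingPairs _ _ hij hil hjl] at this
  simp [rankOf, hij, hil, hjl, hij.symm, hil.symm] at this
  linarith

theorem Network.Achievable.downlink_three {R : Node → Node → ℝ} (hR : net.Achievable R)
    {i j l m : Fin 3} (hij : i ≠ j) (hil : i ≠ l) (hjl : j ≠ l)
    (hm : ∀ i, net.down i ≤ net.down m) :
    R node4 i + R node4 j + R node4 l + R i j + R i l + R j l ≤ net.down m := by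
  have := hR.downlink_bound (rankOf i j 0 1 2 3) m (fun a => Nat.zero_le _) fun i => .inl (hm i)
  rw [sum_risingPairs _ _ hij hil hjl] at this
  simp [rankOf, hij, hil, hjl, hij.symm, hil.symm, hjl.symm] at this
  linarith

theorem Network.Achievable.downlink_two {R : Node → Node → ℝ} (hR : net.Achievable R)
    {i j l m : Fin 3} (hij : i ≠ j) (hil : i ≠ l) (hjl : j ≠ l) (hi : net.down i ≤ net.down m)
    (hj : net.down j ≤ net.down m) :
    R node4 i + R node4 j + R l i + R l j + R i j ≤ net.down m := by
  have := hR.downlink_bound (rankOf i j 0 1 2 0) m (fun a => Nat.zero_le _) fun k => by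
    by_cases hki : k = i
    · exact .inl (hki ▸ hi)
    by_cases hkj : k = j
    · exact .inl (hkj ▸ hj)
    exact .inr fun a => by simp [rankOf, hki, hkj]
  rw [sum_risingPairs _ _ hij hil hjl] at this
  simp [rankOf, hij, hil, hjl, hij.symm, hil.symm, hjl.symm] at this
  linarith

theorem Network.Achievable.downlink_one {R : Node → Node → ℝ} (hR : net.Achievable R)
    {i j l : Fin 3} (hij : i ≠ j) (hil : i ≠ l) (hjl : j ≠ l) :
    R j i + R l i + R node4 i ≤ net.down i := by
  have := hR.downlink_bound (rankOf i j 0 1 0 0) i (fun a => Nat.zero_le _) fun k => by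
    by_cases hki : k = i
    · exact .inl (hki ▸ le_rfl)
    · exact .inr fun a => by simp [rankOf, hki]
  rw [sum_risingPairs _ _ hij hil hjl] at this
  simp [rankOf, hij, hil, hjl, hij.symm, hil.symm] at this
  linarith

end Converse

/-! ### Splitting the messages into pairs, cycles and plain bits -/

/-- The role of a message bit in the linear scheme: `paired` bits of `i → j` are matched with bits
of `j → i`, `cyclic` bits belong to a directed triangle of bits `i → j → l → i` between the users,
and `plain` bits are sent on their own. -/
inductive Kind
  | paired
  | cyclic
  | plain
  deriving DecidableEq

instance : Fintype Kind := ⟨{.paired, .cyclic, .plain}, fun κ => by cases κ <;> simp⟩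

theorem Kind.sum_eq {α : Type*} [AddCommMonoid α] (f : Kind → α) :
    ∑ κ, f κ = f .paired + f .cyclic + f .plain := by
  have : (Finset.univ : Finset Kind) = {.paired, .cyclic, .plain} := rfl
  rw [this, Finset.sum_insert (by simp), Finset.sum_insert (by simp), Finset.sum_singleton,
    add_assoc]

/-- The number of directed triangles `x → x + o → x + 2 o → x` left after pairing: the least
excess of the demand of `x → x + o` over that of the reverse direction. -/
def cycles (r : Node → Node → ℕ) (o : Fin 3) : ℕ :=
  min (r (0 : Fin 3) (0 + o : Fin 3) - r (0 + o : Fin 3) (0 : Fin 3))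
    (min (r (1 : Fin 3) (1 + o : Fin 3) - r (1 + o : Fin 3) (1 : Fin 3))
      (r (2 : Fin 3) (2 + o : Fin 3) - r (2 + o : Fin 3) (2 : Fin 3)))

theorem min_users {u v t : Fin 3} (huv : u ≠ v) (hut : u ≠ t) (hvt : v ≠ t) (f : Fin 3 → ℕ) :
    min (f 0) (min (f 1) (f 2)) = min (f u) (min (f v) (f t)) := by
  fin_cases u <;> fin_cases v <;> fin_cases t <;> simp at huv hut hvt ⊢ <;> omega

theorem cycles_eq (r : Node → Node → ℕ) {u v t : Fin 3} (huv : u ≠ v) (hut : u ≠ t)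
    (hvt : v ≠ t) :
    cycles r (v - u) = min (r u v - r v u) (min (r v t - r t v) (r t u - r u t)) := by
  have h1 : u + (v - u) = v := by clear hut hvt huv; revert u v; decide
  have h2 : v + (v - u) = t := by revert u v t; decide
  have h3 : t + (v - u) = u := by revert u v t; decide
  have := min_users huv hut hvt fun x => r x (x + (v - u) : Fin 3) - r (x + (v - u) : Fin 3) x
  simp only [h1, h2, h3] at this
  exact this

theorem cycles_zero (r : Node → Node → ℕ) : cycles r 0 = 0 := by simp [cycles]

/-- The number of bits of each kind from one node to another. -/
def numBits (r : Node → Node → ℕ) : Node → Node → Kind → ℕ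
  | some i, some j, .paired => min (r i j) (r j i)
  | some i, some j, .cyclic => cycles r (j - i)
  | some i, some j, .plain => r i j - r j i - cycles r (j - i)
  | none, b, .plain => r none b
  | a, none, .plain => r a none
  | _, _, _ => 0

theorem exists_third {i j : Fin 3} (hij : i ≠ j) : ∃ l : Fin 3, i ≠ l ∧ j ≠ l := by
  revert i j; decide

theorem numBits_sum (r : Node → Node → ℕ) (a b : Node) : ∑ κ, numBits r a b κ = r a b := by
  rw [Kind.sum_eq]
  match a, b with
  | none, none => simp [numBits]
  | none, some j => simp [numBits]
  | some i, none => simp [numBits]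
  | some i, some j =>
    simp only [numBits]
    by_cases hij : i = j
    · subst hij
      simp [cycles_zero]
    · obtain ⟨l, hil, hjl⟩ := exists_third hij
      rw [cycles_eq r hij hil hjl]
      omega

theorem numBits_transpose (r : Node → Node → ℕ) (a b : Node) (κ : Kind) :
    numBits (fun a b => r b a) a b κ = numBits r b a κ := by
  have hc : ∀ i j : Fin 3, cycles (fun a b => r b a) (j - i) = cycles r (i - j) := by
    intro i j
    by_cases hij : i = j
    · simp [hij, cycles_zero]
    · obtain ⟨l, hil, hjl⟩ := exists_third hij
      rw [cycles_eq _ hij hil hjl, cycles_eq r (Ne.symm hij) hjl hil]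
      omega
  rcases a with _ | i <;> rcases b with _ | j <;> cases κ <;> simp [numBits, hc, min_comm]

/-- The position of a user in the order `t, v, u` of increasing gains. -/
def position (v t : Fin 3) (i : Fin 3) : ℕ := if i = t then 0 else if i = v then 1 else 2

/-- The number of signal levels that user `i` needs for the bits of each kind exchanged with `b`.
A pair takes one level at its weaker user, and a triangle takes one level at each of its users
except the strongest one `u`. -/
def numLevels (r : Node → Node → ℕ) (u v t : Fin 3) (i : Fin 3) : Node → Kind → ℕ
  | none, .paired => 0
  | some j, .paired => if position v t i < position v t j then numBits r i j .paired else 0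
  | b, .cyclic => if i = u then 0 else numBits r i b .cyclic
  | b, .plain => numBits r i b .plain

/-- The levels needed by user `i`. -/
abbrev LevelOf (r : Node → Node → ℕ) (u v t : Fin 3) (i : Fin 3) : Type :=
  Σ (b : Node) (κ : Kind), Fin (numLevels r u v t i b κ)

theorem sum_numLevels_none (r : Node → Node → ℕ) (u v t i : Fin 3) :
    ∑ κ, numLevels r u v t i none κ = r i none := by
  simp [Kind.sum_eq, numLevels, numBits]

theorem sum_numLevels_of_lt (r : Node → Node → ℕ) {u v t i j : Fin 3} (hi : i ≠ u)
    (hij : position v t i < position v t j) : ∑ κ, numLevels r u v t i j κ = r i j := by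
  rw [← numBits_sum r i j]
  simp [Kind.sum_eq, numLevels, hi, hij]

theorem sum_numLevels_of_le (r : Node → Node → ℕ) {u v t i j : Fin 3} (hi : i ≠ u)
    (hij : position v t j ≤ position v t i) :
    ∑ κ, numLevels r u v t i j κ = r i j - r j i := by
  have h := numBits_sum r i j
  have hp : numBits r i j .paired = min (r i j) (r j i) := rfl
  simp only [Kind.sum_eq] at h
  simp only [Kind.sum_eq, numLevels, hi, hij.not_gt, if_false]
  omega

/-- The strongest user saves one level for each triangle that uses its bits to `j`; its levels and
the saved ones make up its excess demand towards `j`. -/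
theorem sum_numLevels_strongest (r : Node → Node → ℕ) {u v t j : Fin 3}
    (hij : position v t j ≤ position v t u) :
    ∑ κ, numLevels r u v t u j κ + cycles r (j - u) = r u j - r j u := by
  have h := numBits_sum r u j
  have hp : numBits r u j .paired = min (r u j) (r j u) := rfl
  have hc : numBits r u j .cyclic = cycles r (j - u) := rfl
  simp only [Kind.sum_eq] at h
  simp only [Kind.sum_eq, numLevels, hij.not_gt, if_false, if_true]
  omega

theorem card_levelOf (r : Node → Node → ℕ) {u v t : Fin 3} (huv : u ≠ v) (hut : u ≠ t)
    (hvt : v ≠ t) (i : Fin 3) : Fintype.card (LevelOf r u v t i) =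
      r i none + (∑ κ, numLevels r u v t i u κ +
        ∑ κ, numLevels r u v t i v κ + ∑ κ, numLevels r u v t i t κ) := by
  simp only [LevelOf, Fintype.card_sigma, Fintype.card_fin, Fintype.sum_option]
  rw [sum_users huv hut hvt, sum_numLevels_none]

theorem eq_or_eq_or_eq {u v t : Fin 3} (huv : u ≠ v) (hut : u ≠ t) (hvt : v ≠ t) (k : Fin 3) :
    k = u ∨ k = v ∨ k = t := by
  revert u v t k; decide

/-- Elements that belong to three users can be placed on distinct levels, below the gains of their
users, if for each user the elements of all the users that are no stronger fit. -/
theorem exists_nested_placement {T : Fin 3 → Type} [∀ i, Fintype (T i)] {a : Fin 3 → ℕ}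
    {u v t : Fin 3} (huv : u ≠ v) (hut : u ≠ t) (hvt : v ≠ t)
    (ht : Fintype.card (T t) ≤ a t) (hv : Fintype.card (T t) + Fintype.card (T v) ≤ a v)
    (hu : Fintype.card (T t) + Fintype.card (T v) + Fintype.card (T u) ≤ a u) :
    ∃ f : (Σ i, T i) → ℕ, f.Injective ∧ ∀ x, f x < a x.1 := by
  classical
  have hcases := eq_or_eq_or_eq huv hut hvt
  let off : Fin 3 → ℕ := fun i =>
    if i = t then 0 else if i = v then Fintype.card (T t) else
      Fintype.card (T t) + Fintype.card (T v)
  have ot : off t = 0 := by simp [off]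
  have ov : off v = Fintype.card (T t) := by simp [off, hvt]
  have ou : off u = Fintype.card (T t) + Fintype.card (T v) := by simp [off, hut, huv]
  let e : ∀ i, T i ≃ Fin (Fintype.card (T i)) := fun i => Fintype.equivFin _
  refine ⟨fun x => off x.1 + e x.1 x.2, ?_, ?_⟩
  · rintro ⟨i, x⟩ ⟨j, y⟩ h
    have hx := (e i x).isLt
    have hy := (e j y).isLt
    simp only at h
    have hij : i = j := by
      rcases hcases i with rfl | rfl | rfl <;> rcases hcases j with rfl | rfl | rfl <;>
        first | rfl | (exfalso; omega)
    subst hij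
    have : e i x = e i y := Fin.ext (by omega)
    rw [(e i).injective this]
  · rintro ⟨i, x⟩
    have hx := (e i x).isLt
    rcases hcases i with rfl | rfl | rfl <;> simp only <;> omega

/-- The uplink inequalities for integer demands `r` and gains `a`; those of the downlink are
obtained by reversing all demands. -/
structure Fits (r : Node → Node → ℕ) (a : Fin 3 → ℕ) (u v t : Fin 3) : Prop where
  huv : u ≠ v
  hut : u ≠ t
  hvt : v ≠ t
  hle₁ : a v ≤ a u
  hle₂ : a t ≤ a v
  diag : ∀ i, r i i = 0
  one : r t u + r t v + r t node4 ≤ a t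
  two : r t node4 + r v node4 + r t u + r v u + max (r t v) (r v t) ≤ a v
  three_u : r u node4 + r v node4 + r t node4 + r u v + r u t + max (r t v) (r v t) ≤ a u
  three_v : r u node4 + r v node4 + r t node4 + r v u + r v t + max (r t u) (r u t) ≤ a u
  three_t : r u node4 + r v node4 + r t node4 + r t u + r t v + max (r u v) (r v u) ≤ a u

/-- The levels needed by the scheme can be chosen so that each user reaches its own. Its levels
number as many as the most demanding order of the users: pairing leaves one direction for each pair
of users, so that the remaining demands are acyclic up to the triangles of one orientation. -/
theorem Fits.exists_placement {r : Node → Node → ℕ} {a : Fin 3 → ℕ} {u v t : Fin 3}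
    (h : Fits r a u v t) :
    ∃ f : (Σ i, LevelOf r u v t i) → ℕ, f.Injective ∧ ∀ x, f x < a x.1 := by
  obtain ⟨huv, hut, hvt, -, -, diag, h1, h2, h3, h4, h5⟩ := h
  simp only [node4] at h1 h2 h3 h4 h5
  have c1 := cycles_eq r huv hut hvt
  have c2 := cycles_eq r hut huv hvt.symm
  have pt : position v t t = 0 := by simp [position]
  have pv : position v t v = 1 := by simp [position, hvt]
  have pu : position v t u = 2 := by simp [position, huv, hut]
  have kt : Fintype.card (LevelOf r u v t t) = r t none + (r t u + r t v + 0) := by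
    rw [card_levelOf r huv hut hvt, sum_numLevels_of_lt r hut.symm (by omega),
      sum_numLevels_of_lt r hut.symm (by omega), sum_numLevels_of_le r hut.symm le_rfl,
      Nat.sub_self]
  have kv : Fintype.card (LevelOf r u v t v) = r v none + (r v u + 0 + (r v t - r t v)) := by
    rw [card_levelOf r huv hut hvt, sum_numLevels_of_lt r huv.symm (by omega),
      sum_numLevels_of_le r huv.symm le_rfl, sum_numLevels_of_le r huv.symm (by omega),
      Nat.sub_self]
  have ku : Fintype.card (LevelOf r u v t u) + (cycles r (v - u) + cycles r (t - u)) =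
      r u none + ((r u v - r v u) + (r u t - r t u)) := by
    rw [card_levelOf r huv hut hvt,
      ← sum_numLevels_strongest r (v := v) (t := t) (j := v) (by omega),
      ← sum_numLevels_strongest r (v := v) (t := t) (j := t) (by omega)]
    have := sum_numLevels_strongest r (u := u) (v := v) (t := t) (j := u) le_rfl
    omega
  refine exists_nested_placement huv hut hvt (by omega) (by omega) ?_
  -- the direction left for each pair of users selects the inequality for `a u` that applies; the
  -- levels saved are needed only if these directions form a triangle
  clear pt pv pu diag huv hut hvt
  generalize cycles r (v - u) = x at *
  generalize cycles r (t - u) = x' at *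
  generalize Fintype.card (LevelOf r u v t u) = nu at *
  generalize Fintype.card (LevelOf r u v t v) = nv at *
  generalize Fintype.card (LevelOf r u v t t) = nt at *
  rcases le_total (r u v) (r v u) with h6 | h6 <;> rcases le_total (r u t) (r t u) with h7 | h7 <;>
    rcases le_total (r v t) (r t v) with h8 | h8 <;>
    simp only [h6, h7, h8, max_eq_left, max_eq_right, Nat.sub_eq_zero_of_le, zero_min, min_zero]
      at h2 h3 h4 h5 c1 c2 kv ku <;> omega

/-! ### A linear scheme for one block -/

/-- Message bits: `m a b κ k` is bit number `k` of kind `κ` of the message from `a` to `b`. -/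
abbrev Bits := Node → Node → Kind → ℕ → ZMod 2

/-- Beyond the numbers of bits prescribed by the demands `r`, all bits are padded with zeros. -/
def Bits.Padded (r : Node → Node → ℕ) (m : Bits) : Prop :=
  ∀ a b κ k, numBits r a b κ ≤ k → m a b κ k = 0

/-- Equality of everything that the relay extracts from the uplink: the plain bits (among them all
bits addressed to the relay), the sums of paired bits, and the sums of consecutive bits of each
triangle. -/
structure SameSums (m m' : Bits) : Prop where
  plain : ∀ (i : Fin 3) (b : Node) (k : ℕ), m i b .plain k = m' i b .plain k
  paired : ∀ (i j : Fin 3) (k : ℕ),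
    m i j .paired k + m j i .paired k = m' i j .paired k + m' j i .paired k
  cyclic : ∀ (i j : Fin 3) (k : ℕ), m i j .cyclic k + m j (j + (j - i) : Fin 3) .cyclic k =
    m' i j .cyclic k + m' j (j + (j - i) : Fin 3) .cyclic k

theorem position_injective {u v t : Fin 3} (huv : u ≠ v) (hut : u ≠ t) (hvt : v ≠ t) {i j : Fin 3}
    (h : position v t i = position v t j) : i = j := by
  revert u v t i j; decide

theorem Fits.mono {r : Node → Node → ℕ} {a : Fin 3 → ℕ} {u v t : Fin 3} (h : Fits r a u v t)
    {i j : Fin 3} (hij : position v t i ≤ position v t j) : a i ≤ a j := by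
  have h1 := h.hle₁
  have h2 := h.hle₂
  have hvt := h.hvt
  rcases eq_or_eq_or_eq h.huv h.hut h.hvt i with rfl | rfl | rfl <;>
    rcases eq_or_eq_or_eq h.huv h.hut h.hvt j with rfl | rfl | rfl <;>
    simp [position, h.huv, h.hut, h.hvt] at hij <;> omega

theorem Fits.le_strongest {r : Node → Node → ℕ} {a : Fin 3 → ℕ} {u v t : Fin 3}
    (h : Fits r a u v t) (i : Fin 3) : a i ≤ a u := by
  apply h.mono
  simp only [position, if_neg h.hut, if_neg h.huv]
  split_ifs <;> omega

/-- The contribution of user `i`, with messages `own`, to a level of the uplink. -/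
def uplinkBit {r : Node → Node → ℕ} {u v t : Fin 3} (i : Fin 3) (own : Node → Kind → ℕ → ZMod 2) :
    (Σ i, LevelOf r u v t i) → ZMod 2
  | ⟨i', some j, .paired, k⟩ =>
    (if i' = i then own j .paired k else 0) + (if j = i then own i' .paired k else 0)
  | ⟨i', some j, .cyclic, k⟩ => (if i' = i then own j .cyclic k else 0) +
    (if u = i then own (u + (j - i') : Fin 3) .cyclic k else 0)
  | ⟨i', b, κ, k⟩ => if i' = i then own b κ k else 0

theorem Fits.lt_of_uplinkBit_ne_zero {r : Node → Node → ℕ} {a : Fin 3 → ℕ} {u v t : Fin 3}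
    (h : Fits r a u v t) {i : Fin 3} {own : Node → Kind → ℕ → ZMod 2}
    {x : Σ i, LevelOf r u v t i} (hx : uplinkBit i own x ≠ 0) : a x.1 ≤ a i := by
  obtain ⟨i', b, κ, k⟩ := x
  by_cases hi : i' = i
  · exact hi ▸ le_rfl
  have hk := k.2
  match b, κ with
  | none, .paired => simp [uplinkBit, hi] at hx
  | none, .cyclic => simp [uplinkBit, hi] at hx
  | none, .plain => simp [uplinkBit, hi] at hx
  | some j, .plain => simp [uplinkBit, hi] at hx
  | some j, .paired =>
    have hj : j = i := by by_contra hj; simp [uplinkBit, hi, hj] at hx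
    subst hj
    simp only [numLevels] at hk
    split_ifs at hk with hlt
    · exact h.mono hlt.le
    · omega
  | some j, .cyclic =>
    have hj : u = i := by by_contra hj; simp [uplinkBit, hi, hj] at hx
    exact hj ▸ h.le_strongest _

/-- Integer demands that fit the uplink gains can be sent in one block, in which user `i` reaches
the levels below `a i`, so that the relay learns all the sums of `SameSums`. -/
theorem Fits.exists_uplink {r : Node → Node → ℕ} {a : Fin 3 → ℕ} {u v t : Fin 3}
    (h : Fits r a u v t) : ∃ enc : Fin 3 → (Node → Kind → ℕ → ZMod 2) → ℕ → ZMod 2,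
      ∀ m m' : Bits, m.Padded r → m'.Padded r →
        (∀ p, (∑ i, if p < a i then enc i (m i) p else 0) =
          ∑ i, if p < a i then enc i (m' i) p else 0) → SameSums m m' := by
  obtain ⟨f, hf, hfa⟩ := h.exists_placement
  refine ⟨fun i own => Function.extend f (uplinkBit i own) 0, ?_⟩
  intro m m' hm hm' hy
  have hrec : ∀ (m : Bits) x, (∑ i, if f x < a i then
      Function.extend f (uplinkBit i (m i)) 0 (f x) else 0) = ∑ i, uplinkBit i (m i) x := by
    intro m x
    refine Finset.sum_congr rfl fun i _ => ?_
    rw [hf.extend_apply]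
    split_ifs with hlt
    · rfl
    · by_contra hne
      exact hlt ((hfa x).trans_le (h.lt_of_uplinkBit_ne_zero (Ne.symm hne)))
  have hx : ∀ x, ∑ i, uplinkBit i (m i) x = ∑ i, uplinkBit i (m' i) x := fun x => by
    rw [← hrec m x, ← hrec m' x, hy]
  have hlevel : ∀ (i : Fin 3) (j : Fin 3) (k : ℕ), position v t i < position v t j →
      m i j .paired k + m j i .paired k = m' i j .paired k + m' j i .paired k := by
    intro i j k hij
    by_cases hk : k < numBits r i j .paired
    · have := hx ⟨i, some j, .paired, k, by simpa [numLevels, hij] using hk⟩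
      simpa [uplinkBit, Finset.sum_add_distrib] using this
    · have hk' : numBits r j i .paired ≤ k := by
        rw [not_lt] at hk
        simpa only [numBits, min_comm] using hk
      rw [hm _ _ _ _ (not_lt.1 hk), hm' _ _ _ _ (not_lt.1 hk), hm _ _ _ _ hk', hm' _ _ _ _ hk']
  have hcyc : ∀ (i j : Fin 3) (k : ℕ),
      m i j .cyclic k + m u (u + (j - i) : Fin 3) .cyclic k =
        m' i j .cyclic k + m' u (u + (j - i) : Fin 3) .cyclic k := by
    intro i j k
    by_cases hi : i = u
    · subst hi
      rw [add_sub_cancel, CharTwo.add_self_eq_zero, CharTwo.add_self_eq_zero]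
    by_cases hk : k < numBits r i j .cyclic
    · have := hx ⟨i, some j, .cyclic, k, by simpa [numLevels, hi] using hk⟩
      simpa [uplinkBit, Finset.sum_add_distrib] using this
    · have hk' : numBits r u (u + (j - i) : Fin 3) .cyclic ≤ k := by
        simpa [numBits] using hk
      rw [hm _ _ _ _ (not_lt.1 hk), hm' _ _ _ _ (not_lt.1 hk), hm _ _ _ _ hk', hm' _ _ _ _ hk']
  refine ⟨fun i b k => ?_, fun i j k => ?_, fun i j k => ?_⟩
  · by_cases hk : k < numBits r i b .plain
    · have := hx ⟨i, b, .plain, k, by cases b <;> simpa [numLevels] using hk⟩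
      cases b <;> simpa [uplinkBit] using this
    · rw [hm _ _ _ _ (not_lt.1 hk), hm' _ _ _ _ (not_lt.1 hk)]
  · rcases lt_trichotomy (position v t i) (position v t j) with hij | hij | hij
    · exact hlevel i j k hij
    · rw [position_injective h.huv h.hut h.hvt hij, CharTwo.add_self_eq_zero,
        CharTwo.add_self_eq_zero]
    · rw [add_comm, hlevel j i k hij, add_comm]
  · -- the two sums with the bit of the strongest user add up, as that bit cancels
    have h1 := hcyc i j k
    have h2 := hcyc j (j + (j - i)) k
    rw [add_sub_cancel_left] at h2
    have two : (2 : ZMod 2) = 0 := CharTwo.two_eq_zero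
    linear_combination h1 + h2 - (m u (u + (j - i) : Fin 3) .cyclic k -
      m' u (u + (j - i) : Fin 3) .cyclic k) * two

theorem triangle_walk {i j : Fin 3} (hij : i ≠ j) : j + (j - i) ≠ j ∧
    j + (j - i) + (j + (j - i) - j) = i ∧ i + (i - (j + (j - i))) = j := by
  revert i j; decide

/-- The bit that the relay places on a level of the downlink. -/
def downlinkBit {r : Node → Node → ℕ} {w y z : Fin 3} (m : Bits) :
    (Σ j, LevelOf r w y z j) → ZMod 2
  | ⟨j, some i, .paired, k⟩ => m i j .paired k + m j i .paired k
  | ⟨j, some i, .cyclic, k⟩ => m i j .cyclic k + m j (j + (j - i) : Fin 3) .cyclic k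
  | ⟨j, b, κ, k⟩ => m b j κ k

/-- Integer demands whose reversal fits the downlink gains can be delivered in one block, in which
user `j` sees the levels below `b j`, by sending a function of what the relay knows. -/
theorem Fits.exists_downlink {r : Node → Node → ℕ} {b : Fin 3 → ℕ} {w y z : Fin 3}
    (h : Fits (fun i j => r j i) b w y z) : ∃ send : Bits → ℕ → ZMod 2,
      (∀ m m' : Bits, m.Padded r → m'.Padded r → m node4 = m' node4 → SameSums m m' →
        send m = send m') ∧
      ∀ m m' : Bits, m.Padded r → m'.Padded r → ∀ j : Fin 3, m j = m' j →
        (∀ p < b j, send m p = send m' p) → ∀ c, m c j = m' c j := by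
  obtain ⟨g, hg, hgb⟩ := h.exists_placement
  refine ⟨fun m => Function.extend g (downlinkBit m) 0, ?_, ?_⟩
  · intro m m' hm hm' h4 hs
    have : (downlinkBit m : (Σ j, LevelOf (fun i j => r j i) w y z j) → ZMod 2) =
        downlinkBit m' := by
      funext ⟨j, c, κ, k⟩
      match c, κ with
      | none, .paired => simp [downlinkBit, h4]
      | none, .cyclic => simp [downlinkBit, h4]
      | none, .plain => simp [downlinkBit, h4]
      | some i, .plain => exact hs.plain i j k
      | some i, .paired => exact hs.paired i j k
      | some i, .cyclic => exact hs.cyclic i j k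
    simp only [this]
  · intro m m' hm hm' j hj hsend
    have hx : ∀ x : (Σ j, LevelOf (fun i j => r j i) w y z j), b x.1 ≤ b j →
        downlinkBit m x = downlinkBit m' x := by
      intro x hxj
      have := hsend (g x) ((hgb x).trans_le hxj)
      simpa only [hg.extend_apply] using this
    have own : ∀ c κ k, m j c κ k = m' j c κ k := fun c κ k => by rw [hj]
    -- the levels of the triangles, each carrying the bits into and out of one user
    have hcyc : ∀ (i l : Fin 3) (k : ℕ), l ≠ w → b l ≤ b j →
        m i l .cyclic k + m l (l + (l - i) : Fin 3) .cyclic k =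
          m' i l .cyclic k + m' l (l + (l - i) : Fin 3) .cyclic k := by
      intro i l k hl hlj
      by_cases hk : k < numBits r i l .cyclic
      · exact hx ⟨l, some i, .cyclic, k,
          by simpa [numLevels, hl, numBits_transpose] using hk⟩ hlj
      · have hk' : numBits r l (l + (l - i) : Fin 3) .cyclic ≤ k := by
          simpa [numBits] using hk
        rw [hm _ _ _ _ (not_lt.1 hk), hm' _ _ _ _ (not_lt.1 hk), hm _ _ _ _ hk', hm' _ _ _ _ hk']
    intro c
    funext κ k
    by_cases hk : k < numBits r c j κ
    swap
    · rw [hm _ _ _ _ (not_lt.1 hk), hm' _ _ _ _ (not_lt.1 hk)]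
    match c, κ with
    | c, .plain =>
      have := hx ⟨j, c, .plain, k,
        by cases c <;> simpa [numLevels, numBits_transpose] using hk⟩ le_rfl
      cases c <;> exact this
    | none, .paired => simp [numBits] at hk
    | none, .cyclic => simp [numBits] at hk
    | some i, .paired =>
      have hpair : m i j .paired k + m j i .paired k = m' i j .paired k + m' j i .paired k := by
        rcases lt_trichotomy (position y z j) (position y z i) with hij | hij | hij
        · exact hx ⟨j, some i, .paired, k,
            by simpa [numLevels, hij, numBits_transpose] using hk⟩ le_rfl
        · rw [position_injective h.huv h.hut h.hvt hij, CharTwo.add_self_eq_zero,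
            CharTwo.add_self_eq_zero]
        · have hk' : k < numBits r j i .paired := by simpa [numBits, and_comm] using hk
          have := hx ⟨i, some j, .paired, k,
            by simpa [numLevels, hij, numBits_transpose] using hk'⟩ (h.mono hij.le)
          rw [add_comm, add_comm (m' _ _ _ _)]
          exact this
      linear_combination hpair - own i .paired k
    | some i, .cyclic =>
      by_cases hjw : j = w
      · by_cases hij : i = j
        · rw [hij, hj]
        -- the strongest user walks along the triangle from its own bit
        subst hjw
        obtain ⟨e1, e2, e3⟩ := triangle_walk hij
        have h1 := hcyc j (j + (j - i)) k e1 (h.le_strongest _)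
        have h2 := hcyc (j + (j - i)) i k hij (h.le_strongest _)
        rw [e2] at h1
        rw [e3] at h2
        linear_combination h2 - h1 + own (j + (j - i) : Fin 3) .cyclic k
      · linear_combination hcyc i j k hjw le_rfl - own (j + (j - i) : Fin 3) .cyclic k

/-! ### From a block scheme to codes -/

section Codes

variable {net : Network} {M : Node → Node → ℕ}

/-- The first `k` terms of a sequence, the most recent one first. -/
def history {α : Type*} (s : ℕ → α) (k : ℕ) : List α := ((List.range k).map s).reverse

theorem history_succ {α : Type*} (s : ℕ → α) (k : ℕ) : history s (k + 1) = s k :: history s k := by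
  simp [history, List.range_succ]

theorem length_history {α : Type*} (s : ℕ → α) (k : ℕ) : (history s k).length = k := by
  simp [history]

theorem history_eq_iff {α : Type*} {s s' : ℕ → α} {k : ℕ} :
    history s k = history s' k ↔ ∀ l < k, s l = s' l := by
  simp [history]

/-- What each node receives in each network use if the users send `xU` and the relay `xR`. -/
def observed (net : Network) (xU : ∀ i : Fin 3, (∀ j, Fin (M i j)) → ℕ → net.Signal)
    (xR : Messages M → ℕ → net.Signal) (W : Messages M) : Node → ℕ → net.Signal
  | none => fun k => net.uplink fun i => xU i (W i) k
  | some j => fun k => net.downlink (xR W k) j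

/-- Transmissions in which the users do not use feedback form an error-free code as soon as the
relay signals and the desired messages are determined by what the nodes know. -/
theorem exists_code (W₀ : Messages M) (N : ℕ)
    (xU : ∀ i : Fin 3, (∀ j, Fin (M i j)) → ℕ → net.Signal) (xR : Messages M → ℕ → net.Signal)
    (hrelay : ∀ W W' k, W node4 = W' node4 →
      (∀ l ≤ k, observed net xU xR W node4 l = observed net xU xR W' node4 l) → xR W k = xR W' k)
    (hdec : ∀ W W' (j : Node), W j = W' j →
      (∀ l < N, observed net xU xR W j l = observed net xU xR W' j l) → ∀ i, W i j = W' i j) :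
    ∃ C : Code net M, ∀ W, C.Correct N W := by
  classical
  -- `past` is what `j` would have received with the messages `W`
  let P : (j : Node) → (∀ k, Fin (M j k)) → List net.Signal → Messages M → Prop :=
    fun j own past W => W j = own ∧ past = history (observed net xU xR W j) past.length
  let C : Code net M :=
    { userEnc := fun i own past => xU i own past.length
      relayEnc := fun own past =>
        if h : ∃ W, P node4 own past W then xR h.choose (past.length - 1) else 0
      dec := fun j own past i =>
        if h : ∃ W, P j own past W then h.choose i j else W₀ i j }
  have hP : ∀ W j k, P j (W j) (history (observed net xU xR W j) k) W := fun W j k =>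
    ⟨rfl, by rw [length_history]⟩
  have hrec : ∀ W k j, C.received W k j = history (observed net xU xR W j) k := by
    intro W k
    induction k with
    | zero => intro j; rfl
    | succ k ih =>
      have h4 : C.received W (k + 1) node4 = history (observed net xU xR W node4) (k + 1) := by
        rw [history_succ, ← ih]
        change net.uplink (fun i => xU i (W i) (C.received W k i).length) :: _ = _
        simp only [ih, length_history]
        rfl
      have hsent : C.relayEnc (W node4) (C.received W (k + 1) node4) = xR W k := by
        rw [h4]
        have h : ∃ W', P node4 (W node4) (history (observed net xU xR W node4) (k + 1)) W' :=
          ⟨W, hP W node4 (k + 1)⟩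
        change (if h : _ then _ else _) = _
        rw [dif_pos h, length_history, Nat.add_sub_cancel]
        obtain ⟨h1, h2⟩ := h.choose_spec
        rw [length_history, history_eq_iff] at h2
        exact hrelay _ _ _ h1 fun l hl => (h2 l (Nat.lt_succ_of_le hl)).symm
      intro j
      match j with
      | none => exact h4
      | some j =>
        rw [history_succ, ← ih]
        change net.downlink (C.relayEnc (W node4) (C.received W (k + 1) node4)) j :: _ = _
        rw [hsent]
        rfl
  refine ⟨C, fun W j i => ?_⟩
  have h : ∃ W', P j (W j) (history (observed net xU xR W j) N) W' := ⟨W, hP W j N⟩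
  rw [hrec W N j]
  change (if h : _ then _ else _) = _
  rw [dif_pos h]
  obtain ⟨h1, h2⟩ := h.choose_spec
  rw [length_history, history_eq_iff] at h2
  exact hdec _ _ _ h1 (fun l hl => (h2 l hl).symm) i

/-- The bits of a message that are sent in `K` blocks, in each of which the demand is `r`. -/
theorem exists_bits (r : Node → Node → ℕ) (K : ℕ) (hM : ∀ i j, M i j ≤ 2 ^ (K * r i j)) :
    ∃ φ : ∀ i j, Fin (M i j) → ℕ → Kind → ℕ → ZMod 2,
      (∀ i j x β κ k, numBits r i j κ ≤ k → φ i j x β κ k = 0) ∧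
      ∀ i j x x', (∀ β < K, φ i j x β = φ i j x' β) → x = x' := by
  classical
  have h : ∀ i j, Nonempty (Fin (M i j) ↪ (Fin K → (Σ κ, Fin (numBits r i j κ)) → ZMod 2)) := by
    intro i j
    apply Function.Embedding.nonempty_of_card_le
    simp only [Fintype.card_fin, Fintype.card_fun, Fintype.card_sigma, numBits_sum, ZMod.card]
    rw [← pow_mul, mul_comm]
    exact hM i j
  let e := fun i j => (h i j).some
  refine ⟨fun i j x β κ k => if hβ : β < K then if hk : k < numBits r i j κ then
    e i j x ⟨β, hβ⟩ ⟨κ, k, hk⟩ else 0 else 0, ?_, ?_⟩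
  · intro i j x β κ k hk
    simp [hk.not_gt]
  · intro i j x x' hx
    apply (e i j).injective
    funext β ⟨κ, k⟩
    have := congrFun (congrFun (hx β β.2) κ) k
    simpa using this

/-- Integer demands that fit `L` copies of every level are met without errors by `K` blocks of `L`
network uses, if one more block is available: the relay forwards a block during the next one. -/
theorem exists_block_code {r : Node → Node → ℕ} {L K N : ℕ} (hL : 0 < L) (hN : (K + 1) * L ≤ N)
    {u v t w y z : Fin 3} (hup : Fits r (fun i => net.up i * L) u v t)
    (hdown : Fits (fun i j => r j i) (fun i => net.down i * L) w y z) (W₀ : Messages M)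
    (hM : ∀ i j, M i j ≤ 2 ^ (K * r i j)) : ∃ C : Code net M, ∀ W, C.Correct N W := by
  obtain ⟨enc, henc⟩ := hup.exists_uplink
  obtain ⟨send, hsend, hrecv⟩ := hdown.exists_downlink
  obtain ⟨φ, hφ, hinj⟩ := exists_bits r K hM
  let bits : Messages M → ℕ → Bits := fun W β a b => φ a b (W a b) β
  have hpad : ∀ W β, (bits W β).Padded r := fun W β a b κ k hk => hφ a b _ β κ k hk
  let xU : ∀ i : Fin 3, (∀ j, Fin (M i j)) → ℕ → net.Signal := fun i own k j =>
    enc i (fun b => φ i b (own b) (k / L)) ((net.up i - 1 - j) * L + k % L)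
  let xR : Messages M → ℕ → net.Signal := fun W k j =>
    if k / L = 0 then 0 else send (bits W (k / L - 1)) (j * L + k % L)
  have hlt : ∀ d n s : ℕ, s < L → (d * L + s < n * L ↔ d < n) := by
    intro d n s hs
    constructor
    · intro h
      by_contra! hnd
      have := Nat.mul_le_mul_right L hnd
      omega
    · intro h
      have := Nat.mul_le_mul_right L (Nat.succ_le_of_lt h)
      rw [Nat.succ_mul] at this
      omega
  have hblock : ∀ β p, (β * L + p % L) / L = β ∧ (β * L + p % L) % L = p % L := by
    intro β p
    have hp := Nat.mod_lt p hL
    constructor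
    · rw [mul_comm, Nat.mul_add_div hL, Nat.div_eq_of_lt hp, add_zero]
    · rw [mul_comm, Nat.mul_add_mod, Nat.mod_mod]
  have hend : ∀ β p, β * L + p % L < (β + 1) * L := by
    intro β p
    have hp := Nat.mod_lt p hL
    rw [Nat.succ_mul]
    omega
  -- a block of uplink signals determines all the sums, position `p = d * L + s` being the level
  -- `d`, counted from below, of the network use number `s` of the block
  have hsum : ∀ W W' β, (∀ l < (β + 1) * L, observed net xU xR W node4 l =
      observed net xU xR W' node4 l) → SameSums (bits W β) (bits W' β) := by
    intro W W' β hobs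
    refine henc _ _ (hpad W β) (hpad W' β) fun p => ?_
    have hp := Nat.mod_lt p hL
    obtain ⟨d, hpe⟩ : ∃ d, d * L + p % L = p := ⟨p / L, Nat.div_add_mod' p L⟩
    by_cases hd : d < net.q
    · have := congrFun (hobs _ (hend β p)) ⟨net.q - 1 - d, by omega⟩
      simp only [observed, Network.uplink, Network.shift, Finset.sum_apply, xU, hblock] at this
      convert this using 2 with i _ i _
      all_goals
        have hi := net.up_le_q i
        have hiff := hlt d (net.up i) (p % L) hp
        rw [hpe] at hiff
        by_cases hdi : d < net.up i
        · rw [if_pos (hiff.2 hdi), if_pos (by omega)]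
          have : net.up i - 1 - (net.q - 1 - d - (net.q - net.up i)) = d := by omega
          rw [this, hpe]
        · rw [if_neg (mt hiff.1 hdi), if_neg (by omega)]
    · have hz : ∀ i, ¬ p < net.up i * L := by
        intro i hi
        have := net.up_le_q i
        rw [← hpe, hlt _ _ _ hp] at hi
        omega
      simp [hz]
  refine exists_code W₀ N xU xR ?_ ?_
  · intro W W' k h4 hobs
    funext j
    simp only [xR]
    split_ifs with hk
    · rfl
    · have hs := hsum W W' (k / L - 1) fun l hl => hobs l (by
        have := Nat.div_mul_le_self k L
        rw [Nat.sub_add_cancel (Nat.pos_of_ne_zero hk)] at hl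
        omega)
      rw [hsend _ _ (hpad W _) (hpad W' _) (by funext b; simp only [bits, h4]) hs]
  · intro W W' j hj hobs
    match j with
    | none =>
      intro a
      match a with
      | none => rw [hj]
      | some i =>
        refine hinj _ _ _ _ fun β hβ => ?_
        have hs := hsum W W' β fun l hl => hobs l (hl.trans_le
          ((Nat.mul_le_mul_right L (by omega)).trans hN))
        funext κ k
        match κ with
        | .plain => exact hs.plain i none k
        | .paired => rw [hφ _ _ _ _ _ _ (by simp [numBits]), hφ _ _ _ _ _ _ (by simp [numBits])]
        | .cyclic => rw [hφ _ _ _ _ _ _ (by simp [numBits]), hφ _ _ _ _ _ _ (by simp [numBits])]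
    | some j =>
      intro a
      refine hinj _ _ _ _ fun β hβ => ?_
      refine hrecv (bits W β) (bits W' β) (hpad W β) (hpad W' β) j
        (by funext b; simp only [bits, hj]) (fun p hpj => ?_) a
      have hp := Nat.mod_lt p hL
      obtain ⟨d, hpe⟩ : ∃ d, d * L + p % L = p := ⟨p / L, Nat.div_add_mod' p L⟩
      have hq := net.down_le_q j
      rw [← hpe, hlt _ _ _ hp] at hpj
      have := congrFun (hobs _ ((hend (β + 1) p).trans_le
        ((Nat.mul_le_mul_right L (by omega)).trans hN))) ⟨net.q - net.down j + d, by omega⟩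
      simpa only [observed, Network.downlink, Network.shift, xR, hblock, Nat.succ_ne_zero, if_false,
        Nat.add_sub_cancel, Nat.add_sub_cancel_left, Nat.le_add_right, if_true, hpe] using this

end Codes

/-! ### Rates -/

section Rates

variable {net : Network}

theorem achievable_of_eventually {R : Node → Node → ℝ}
    (h : ∀ᶠ N in atTop, ∃ C : Code net (numMessages R N), ∀ W, C.Correct N W) :
    net.Achievable R := by
  classical
  have hdef : ∀ N, Nonempty (Code net (numMessages R N)) := fun N =>
    ⟨⟨fun _ _ _ => 0, fun _ _ => 0, fun _ _ _ _ => ⟨0, Nat.ceil_pos.2 (by positivity)⟩⟩⟩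
  refine ⟨fun N => if h : ∃ C : Code net (numMessages R N), ∀ W, C.Correct N W then h.choose
    else (hdef N).some, ?_⟩
  refine tendsto_const_nhds.congr' ?_
  filter_upwards [h] with N hN
  rw [dif_pos hN]
  simp [Code.errorProb, hN.choose_spec]

/-- Integer demands per block of `L` network uses that fit `L` copies of every level give
achievable rates, up to any factor `c < 1` that pays for the delay of one block. -/
theorem achievable_of_fits {r : Node → Node → ℕ} {L : ℕ} (hL : 0 < L) {u v t w y z : Fin 3}
    (hup : Fits r (fun i => net.up i * L) u v t)
    (hdown : Fits (fun i j => r j i) (fun i => net.down i * L) w y z) {c : ℝ} (hc : c < 1) :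
    net.Achievable fun i j => c * (r i j / L) := by
  apply achievable_of_eventually
  have hL' : (0 : ℝ) < L := by exact_mod_cast hL
  obtain ⟨N₀, hN₀⟩ := exists_nat_ge (2 * L / (1 - c))
  filter_upwards [eventually_ge_atTop N₀, eventually_ge_atTop L] with N hN hNL
  have hNc : 2 * (L : ℝ) ≤ N * (1 - c) := by
    rw [← div_le_iff₀ (by linarith)]
    exact hN₀.trans (by exact_mod_cast hN)
  have hdiv : 1 ≤ N / L := (Nat.one_le_div_iff hL).2 hNL
  refine exists_block_code (K := N / L - 1) hL ?_ hup hdown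
    (fun i j => ⟨0, Nat.ceil_pos.2 (by positivity)⟩) fun i j => ?_
  · rw [Nat.sub_add_cancel hdiv]
    exact Nat.div_mul_le_self N L
  · refine Nat.ceil_le.2 ?_
    push_cast
    rw [← Real.rpow_natCast]
    refine Real.rpow_le_rpow_of_exponent_le (by norm_num) ?_
    push_cast [hdiv]
    have h1 : (N : ℝ) < ((N / L : ℕ) + 1) * L := by
      have h3 : N < (N / L + 1) * L := by
        rw [add_mul]
        have := Nat.div_add_mod' N L
        have := Nat.mod_lt N hL
        omega
      exact_mod_cast h3
    have h2 : (N : ℝ) * c / L ≤ (N / L : ℕ) - 1 := by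
      rw [div_le_iff₀ hL']
      linarith
    calc (N : ℝ) * (c * (r i j / L)) = N * c / L * r i j := by ring
      _ ≤ _ := mul_le_mul_of_nonneg_right h2 (by positivity)

/-- Rounding down the demands of a block of `L` network uses preserves the inequalities. -/
theorem fits_floor {R : Node → Node → ℝ} (hR : IsRateTuple R) {a : Fin 3 → ℕ} (L : ℕ)
    {u v t : Fin 3} (huv : u ≠ v) (hut : u ≠ t) (hvt : v ≠ t) (hle₁ : a v ≤ a u)
    (hle₂ : a t ≤ a v) (h1 : R t u + R t v + R t node4 ≤ a t)
    (h2 : R t node4 + R v node4 + R t u + R v u + max (R t v) (R v t) ≤ a v)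
    (h3 : R u node4 + R v node4 + R t node4 + R u v + R u t + max (R t v) (R v t) ≤ a u)
    (h4 : R u node4 + R v node4 + R t node4 + R v u + R v t + max (R t u) (R u t) ≤ a u)
    (h5 : R u node4 + R v node4 + R t node4 + R t u + R t v + max (R u v) (R v u) ≤ a u) :
    Fits (fun i j => ⌊R i j * L⌋₊) (fun i => a i * L) u v t := by
  have hL : (0 : ℝ) ≤ L := Nat.cast_nonneg L
  have hfl : ∀ i j, (⌊R i j * L⌋₊ : ℝ) ≤ R i j * L := fun i j =>
    Nat.floor_le (mul_nonneg (hR.1 i j) hL)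
  have hmax : ∀ i j, max (⌊R i j * L⌋₊ : ℝ) (⌊R j i * L⌋₊ : ℝ) ≤ max (R i j) (R j i) * L :=
    fun i j => max_le ((hfl i j).trans (mul_le_mul_of_nonneg_right (le_max_left _ _) hL))
      ((hfl j i).trans (mul_le_mul_of_nonneg_right (le_max_right _ _) hL))
  refine ⟨huv, hut, hvt, Nat.mul_le_mul_right L hle₁, Nat.mul_le_mul_right L hle₂,
    fun i => by simp [hR.2 i], ?_, ?_, ?_, ?_, ?_⟩ <;> rify
  · linarith [mul_le_mul_of_nonneg_right h1 hL, hfl t u, hfl t v, hfl t node4]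
  · linarith [mul_le_mul_of_nonneg_right h2 hL, hfl t node4, hfl v node4, hfl t u, hfl v u,
      hmax t v]
  · linarith [mul_le_mul_of_nonneg_right h3 hL, hfl u node4, hfl v node4, hfl t node4, hfl u v,
      hfl u t, hmax t v]
  · linarith [mul_le_mul_of_nonneg_right h4 hL, hfl u node4, hfl v node4, hfl t node4, hfl v u,
      hfl v t, hmax t u]
  · linarith [mul_le_mul_of_nonneg_right h5 hL, hfl u node4, hfl v node4, hfl t node4, hfl t u,
      hfl t v, hmax u v]

theorem mem_capacityRegion_of_fits {R : Node → Node → ℝ} (hR : IsRateTuple R)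
    {u v t w y z : Fin 3}
    (hup : ∀ L : ℕ, Fits (fun i j => ⌊R i j * L⌋₊) (fun i => net.up i * L) u v t)
    (hdown : ∀ L : ℕ, Fits (fun i j => ⌊R j i * L⌋₊) (fun i => net.down i * L) w y z) :
    R ∈ net.capacityRegion := by
  let c : ℕ → ℝ := fun n => 1 - 1 / ((n : ℝ) + 1)
  have hc0 : ∀ n, 0 ≤ c n := fun n => by
    have : 1 / ((n : ℝ) + 1) ≤ 1 := by
      rw [div_le_one (by positivity)]
      linarith [(Nat.cast_nonneg n : (0 : ℝ) ≤ n)]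
    simpa [c] using this
  have hc1 : ∀ n, c n < 1 := fun n => by
    have : 0 < 1 / ((n : ℝ) + 1) := by positivity
    simp only [c]
    linarith
  have hc : Tendsto c atTop (𝓝 1) := by
    simpa [c] using tendsto_one_div_add_atTop_nhds_zero_nat.const_sub (1 : ℝ)
  refine mem_closure_of_tendsto (b := atTop)
    (f := fun (n : ℕ) i j => c n * (⌊R i j * (n + 1 : ℕ)⌋₊ / (n + 1 : ℕ))) ?_ ?_
  · refine tendsto_pi_nhds.2 fun i => tendsto_pi_nhds.2 fun j => ?_
    have h1 : Tendsto (fun n : ℕ => ((n + 1 : ℕ) : ℝ)) atTop atTop :=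
      tendsto_natCast_atTop_atTop.comp (tendsto_add_atTop_nat 1)
    have h2 := (tendsto_nat_floor_mul_div_atTop (hR.1 i j)).comp h1
    simpa using hc.mul h2
  · refine Eventually.of_forall fun n => ⟨⟨fun i j => ?_, fun i => ?_⟩, ?_⟩
    · exact mul_nonneg (hc0 n) (by positivity)
    · simp [hR.2 i]
    · exact achievable_of_fits n.succ_pos (hup _) (hdown _) (hc1 n)

theorem isClosed_isRateTuple : IsClosed {R : Node → Node → ℝ | IsRateTuple R} := by
  simp only [IsRateTuple, Set.ofPred_and, Set.ofPred_forall]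
  exact (isClosed_iInter fun i => isClosed_iInter fun j => isClosed_le (by fun_prop)
    (by fun_prop)).inter (isClosed_iInter fun i => isClosed_eq (by fun_prop) (by fun_prop))

end Rates

end FourNode

open FourNode in
theorem theorem1 (net : Network) (u v t w y z : Fin 3)
    (huv : u ≠ v) (hut : u ≠ t) (hvt : v ≠ t) (hwy : w ≠ y) (hwz : w ≠ z) (hyz : y ≠ z)
    (hup₁ : net.up v ≤ net.up u) (hup₂ : net.up t ≤ net.up v)
    (hdown₁ : net.down y ≤ net.down w) (hdown₂ : net.down z ≤ net.down y) :
    net.capacityRegion = {R : Node → Node → ℝ | IsRateTuple R ∧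
      R t u + R t v + R t node4 ≤ net.up t ∧
      R w z + R y z + R node4 z ≤ net.down z ∧
      R t node4 + R v node4 + R t u + R v u + max (R t v) (R v t) ≤ net.up v ∧
      R node4 z + R node4 y + R w z + R w y + max (R z y) (R y z) ≤ net.down y ∧
      R u node4 + R v node4 + R t node4 + R u v + R u t + max (R t v) (R v t) ≤ net.up u ∧
      R u node4 + R v node4 + R t node4 + R v u + R v t + max (R t u) (R u t) ≤ net.up u ∧
      R u node4 + R v node4 + R t node4 + R t u + R t v + max (R u v) (R v u) ≤ net.up u ∧
      R node4 w + R node4 y + R node4 z + R w z + R y z + max (R w y) (R y w) ≤ net.down w ∧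
      R node4 w + R node4 y + R node4 z + R y w + R z w + max (R z y) (R y z) ≤ net.down w ∧
      R node4 w + R node4 y + R node4 z + R w y + R z y + max (R w z) (R z w) ≤ net.down w} := by
  apply Set.Subset.antisymm
  · refine closure_minimal ?_ ?_
    · rintro R ⟨hR, hach⟩
      have hup : ∀ i, net.up i ≤ net.up u := fun i => by
        rcases eq_or_eq_or_eq huv hut hvt i with rfl | rfl | rfl <;> omega
      have hdown : ∀ i, net.down i ≤ net.down w := fun i => by
        rcases eq_or_eq_or_eq hwy hwz hyz i with rfl | rfl | rfl <;> omega
      have hvu := huv.symm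
      have htu := hut.symm
      have htv := hvt.symm
      have hyw := hwy.symm
      have hzw := hwz.symm
      have hzy := hyz.symm
      refine ⟨hR, ?_, ?_, ?_, ?_, ?_, ?_, ?_, ?_, ?_, ?_⟩
      · exact hach.uplink_one htu htv huv
      · exact hach.downlink_one hzw hzy hwy
      · rw [← max_add_add_left]
        refine max_le ?_ ?_
        · linarith [hach.uplink_two htv htu hvu hup₂ le_rfl]
        · linarith [hach.uplink_two hvt hvu htu le_rfl hup₂]
      · rw [← max_add_add_left]
        refine max_le ?_ ?_
        · linarith [hach.downlink_two hzy hzw hyw hdown₂ le_rfl]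
        · linarith [hach.downlink_two hyz hyw hzw le_rfl hdown₂]
      · rw [← max_add_add_left]
        refine max_le ?_ ?_
        · linarith [hach.uplink_three hut huv htv hup]
        · linarith [hach.uplink_three huv hut hvt hup]
      · rw [← max_add_add_left]
        refine max_le ?_ ?_
        · linarith [hach.uplink_three hvt hvu htu hup]
        · linarith [hach.uplink_three hvu hvt hut hup]
      · rw [← max_add_add_left]
        refine max_le ?_ ?_
        · linarith [hach.uplink_three htu htv huv hup]
        · linarith [hach.uplink_three htv htu hvu hup]
      · rw [← max_add_add_left]
        refine max_le ?_ ?_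
        · linarith [hach.downlink_three hwy hwz hyz hdown]
        · linarith [hach.downlink_three hyw hyz hwz hdown]
      · rw [← max_add_add_left]
        refine max_le ?_ ?_
        · linarith [hach.downlink_three hzy hzw hyw hdown]
        · linarith [hach.downlink_three hyz hyw hzw hdown]
      · rw [← max_add_add_left]
        refine max_le ?_ ?_
        · linarith [hach.downlink_three hwz hwy hzy hdown]
        · linarith [hach.downlink_three hzw hzy hwy hdown]
    · simp only [Set.ofPred_and]
      refine isClosed_isRateTuple.inter ?_
      repeat' apply IsClosed.inter
      all_goals exact isClosed_le (by fun_prop) (by fun_prop)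
  · rintro R ⟨hR, h1, h2, h3, h4, h5, h6, h7, h8, h9, h10⟩
    have hR' : IsRateTuple fun i j => R j i := ⟨fun i j => hR.1 j i, hR.2⟩
    refine mem_capacityRegion_of_fits hR (u := u) (v := v) (t := t) (w := w) (y := y) (z := z)
      (fun L => fits_floor hR L huv hut hvt hup₁ hup₂ h1 h3 h5 h6 h7) fun L =>
      fits_floor hR' L hwy hwz hyz hdown₁ hdown₂ ?_ ?_ ?_ ?_ ?_
    · linarith
    · rw [max_comm]; linarith
    · linarith [max_comm (R y z) (R z y)]
    · linarith [max_comm (R z w) (R w z)]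
    · linarith [max_comm (R y w) (R w y)]
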